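/- All Lie groups are finite-dimensional, real and smooth ($C^\infty$). A \emph{post-group} is a group $(G,\cdot)$ with an operation $\rhd: G\times G\to G$ such that, for all $a,b,c\in G$, the map $L^\rhd_a: G\to G$, $L^\rhd_a b=a\rhd b$, is an automorphism of the group $(G,\cdot)$, and $(a\cdot(a\rhd b))\rhd c=a\rhd(b\rhd c)$. A \emph{post-Lie group} is a post-group $(G,\cdot,\rhd)$ such that $(G,\cdot)$ is a Lie group and $\rhd$ is smooth; homomorphisms of post-Lie groups are smooth maps preserving $\cdot$ and $\rhd$. A (real) \emph{post-Lie algebra} is a real Lie algebra $(\mathfrak g,[\cdot,\cdot])$ with a bilinear product $\triangleright$ such that, for all $x,y,z\in\mathfrak g$, $$x\triangleright[y,z]=[x\triangleright y,z]+[y,x\triangleright z],\qquad ([x,y]+x\triangleright y-y\triangleright x)\triangleright z=x\triangleright(y\triangleright z)-y\triangleright(x\triangleright z);$$ homomorphisms of post-Lie algebras are Lie algebra homomorphisms preserving $\triangleright$. Let $(G,\cdot,\rhd)$ be a post-Lie group with identity $e$, and let $(\mathfrak g,[\cdot,\cdot])$ be the Lie algebra of $(G,\cdot)$: the tangent space $T_eG$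 with the bracket of left-invariant vector fields. \textbf{Theorem.} (1) The map $a\mapsto (L^\rhd_a)_{*e}$ from $G$ to $\mathrm{End}(\mathfrak g)$ is smooth. Let $L^\rhd_{*e}:\mathfrak g\to\mathrm{End}(\mathfrak g)$ be its differential at $e$ and put $x\triangleright y:=L^\rhd_{*e}(x)(y)$ for $x,y\in\mathfrak g$. Then $$x\triangleright y=\frac{d}{dt}\bigg|_{t=0}(L^\rhd_{\gamma(t)})_{*e}\,y=\frac{d}{dt}\bigg|_{t=0}\frac{d}{ds}\bigg|_{s=0}\gamma(t)\rhd\sigma(s)$$ for all curves $\gamma,\sigma:\mathbb R\to G$ with $\gamma(0)=\sigma(0)=e$ that are differentiable at $0$ with velocities $\gamma'(0)=x$, $\sigma'(0)=y$ (for instance $\gamma(t)=\exp(tx)$, $\sigma(s)=\exp(sy)$), and all derivatives here exist. (2) $(\mathfrak g,[\cdot,\cdot],\triangleright)$ is a post-Lie algebra. (3) If $\Psi:G\to H$ is a homomorphism of post-Lie groups, then $\Psi_{*e}:\mathfrak g\to\mathfrak h$ is a homomorphism from the post-Lie algebra of $G$ to the post-Lie algebra of $H$. (4) The assignments $(G,\cdot,\rhd)\mapsto(\mathfrak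 g,[\cdot,\cdot],\triangleright)$ and $\Psi\mapsto\Psi_{*e}$ form a functor from the category of post-Lie groups to the category of post-Lie algebras. -/

import Mathlib

open CategoryTheory
open scoped Manifold ContDiff

universe u v

noncomputable section

/-- A post-group: a group `(G, ·)` with a second operation `▷` such that every left multiplication
`b ↦ a ▷ b` is an automorphism of `(G, ·)` and `(a · (a ▷ b)) ▷ c = a ▷ (b ▷ c)`. -/
class PostGroup (G : Type u) extends Group G where
  /-- the operation `a ▷ b` -/
  rhd : G → G → G
  rhd_bijective : ∀ a : G, Function.Bijective (rhd a)
  rhd_mul : ∀ a b c : G, rhd a (b * c) = rhd a b * rhd a c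
  rhd_assoc : ∀ a b c : G, rhd (a * rhd a b) c = rhd a (rhd b c)

/-- A post-Lie group: a post-group which is a smooth real Lie group modelled on `E`, such that
`▷ : G × G → G` is smooth. -/
class PostLieGroup (E : Type v) [NormedAddCommGroup E] [NormedSpace ℝ E]
    (G : Type u) [TopologicalSpace G] [ChartedSpace E G] [PostGroup G] : Prop
    extends LieGroup 𝓘(ℝ, E) ∞ G where
  contMDiff_rhd : ContMDiff (𝓘(ℝ, E).prod 𝓘(ℝ, E)) 𝓘(ℝ, E) ∞
    (fun p : G × G => PostGroup.rhd p.1 p.2)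

/-- The category of post-Lie groups has as objects the finite-dimensional real post-Lie groups. -/
structure PostLieGrp where
  /-- the model vector space -/
  E : Type v
  /-- the underlying type -/
  carrier : Type u
  [normedAddCommGroup : NormedAddCommGroup E]
  [normedSpace : NormedSpace ℝ E]
  [finiteDimensional : FiniteDimensional ℝ E]
  [topologicalSpace : TopologicalSpace carrier]
  [chartedSpace : ChartedSpace E carrier]
  [postGroup : PostGroup carrier]
  [postLieGroup : PostLieGroup E carrier]

namespace PostLieGrp

attribute [instance] normedAddCommGroup normedSpace finiteDimensional topologicalSpace
  chartedSpace postGroup postLieGroup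

instance : CoeSort PostLieGrp.{u, v} (Type u) := ⟨PostLieGrp.carrier⟩

instance (G : PostLieGrp.{u, v}) : CompleteSpace G.E := FiniteDimensional.complete ℝ G.E

instance (G : PostLieGrp.{u, v}) : LieGroup 𝓘(ℝ, G.E) (minSmoothness ℝ 3) G :=
  LieGroup.of_le (n := ∞)
    (by rw [minSmoothness_of_isRCLikeNormedField]; exact ENat.LEInfty.out)

/-- A homomorphism of post-Lie groups: a smooth map preserving `·` and `▷`. -/
@[ext]
structure Hom (G H : PostLieGrp.{u, v}) where
  /-- the underlying map -/
  toFun : G → H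
  map_mul : ∀ a b : G, toFun (a * b) = toFun a * toFun b
  map_rhd : ∀ a b : G, toFun (PostGroup.rhd a b) = PostGroup.rhd (toFun a) (toFun b)
  contMDiff : ContMDiff 𝓘(ℝ, G.E) 𝓘(ℝ, H.E) ∞ toFun

instance : Category PostLieGrp.{u, v} where
  Hom := Hom
  id G := ⟨id, fun _ _ => rfl, fun _ _ => rfl, contMDiff_id⟩
  comp f g := ⟨g.toFun ∘ f.toFun,
    fun a b => by simp [f.map_mul, g.map_mul],
    fun a b => by simp [f.map_rhd, g.map_rhd],
    g.contMDiff.comp f.contMDiff⟩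

/-- The Lie algebra `𝔤` of `(G, ·)`: the tangent space at the identity, with the bracket of
left-invariant vector fields. -/
abbrev lieAlg (G : PostLieGrp.{u, v}) : Type v := GroupLieAlgebra 𝓘(ℝ, G.E) G

/-- The map `G → End 𝔤`, `a ↦ (L_a)_{*e}`, where `L_a b = a ▷ b`. The value at `a` is a map into
the tangent space at `a ▷ e = e`, that is, into `𝔤`. As a vector space `𝔤` is the model space `E`,
which gives `End 𝔤` its normed space structure. -/
def leftDeriv (G : PostLieGrp.{u, v}) (a : G) : G.E →L[ℝ] G.E :=
  mfderiv 𝓘(ℝ, G.E) 𝓘(ℝ, G.E) (fun b : G => PostGroup.rhd a b) 1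

/-- The map `L_{*e} : 𝔤 → End 𝔤`, the differential at the identity of `a ↦ (L_a)_{*e}`. -/
def leftDerivDeriv (G : PostLieGrp.{u, v}) : G.E →L[ℝ] G.E →L[ℝ] G.E :=
  mfderiv 𝓘(ℝ, G.E) 𝓘(ℝ, G.E →L[ℝ] G.E) G.leftDeriv 1

/-- The product `x ▷ y = L_{*e}(x)(y)` on `𝔤`. -/
def tri (G : PostLieGrp.{u, v}) : G.lieAlg →ₗ[ℝ] G.lieAlg →ₗ[ℝ] G.lieAlg :=
  LinearMap.mk₂ ℝ (fun x y => G.leftDerivDeriv x y)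
    (fun x x' y => congrArg (fun T : G.E →L[ℝ] G.E => T y) (G.leftDerivDeriv.map_add x x'))
    (fun c x y => congrArg (fun T : G.E →L[ℝ] G.E => T y) (G.leftDerivDeriv.map_smul c x))
    (fun x y y' => (G.leftDerivDeriv x).map_add y y')
    (fun c x y => (G.leftDerivDeriv x).map_smul c y)

/-- `γ` is a curve in `G` through the identity with velocity `x` at time `0`
(for instance `t ↦ exp (t x)`). -/
structure IsCurveAt (G : PostLieGrp.{u, v}) (γ : ℝ → G) (x : G.lieAlg) : Prop where
  map_zero : γ 0 = 1
  mdifferentiableAt : MDifferentiableAt 𝓘(ℝ, ℝ) 𝓘(ℝ, G.E) γ 0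
  velocity : (mfderiv 𝓘(ℝ, ℝ) 𝓘(ℝ, G.E) γ 0 (1 : ℝ) : G.E) = x

/-- The differential `Ψ_{*e} : 𝔤 → 𝔥` of a homomorphism of post-Lie groups, with values in the
tangent space at `Ψ e = e`. -/
def Hom.tangent {G H : PostLieGrp.{u, v}} (Ψ : Hom G H) : G.lieAlg →ₗ[ℝ] H.lieAlg :=
  (mfderiv 𝓘(ℝ, G.E) 𝓘(ℝ, H.E) Ψ.toFun 1 : G.E →L[ℝ] H.E).toLinearMap

end PostLieGrp

/-- The axioms of a post-Lie algebra for a bilinear product `▷` on a Lie algebra `L`. -/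
structure IsPostLieAlgebra (R : Type u) [CommRing R] (L : Type v) [LieRing L] [LieAlgebra R L]
    (tri : L →ₗ[R] L →ₗ[R] L) : Prop where
  tri_lie : ∀ x y z : L, tri x ⁅y, z⁆ = ⁅tri x y, z⁆ + ⁅y, tri x z⁆
  lie_tri : ∀ x y z : L,
    tri (⁅x, y⁆ + tri x y - tri y x) z = tri x (tri y z) - tri y (tri x z)

/-- Objects of the category of real post-Lie algebras. -/
structure PostLieAlg where
  /-- the underlying type -/
  carrier : Type v
  [lieRing : LieRing carrier]
  [lieAlgebra : LieAlgebra ℝ carrier]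
  /-- the product `x ▷ y` -/
  tri : carrier →ₗ[ℝ] carrier →ₗ[ℝ] carrier
  isPostLieAlgebra : IsPostLieAlgebra ℝ carrier tri

namespace PostLieAlg

attribute [instance] lieRing lieAlgebra

instance : CoeSort PostLieAlg.{v} (Type v) := ⟨PostLieAlg.carrier⟩

/-- A homomorphism of post-Lie algebras: a Lie algebra homomorphism preserving `▷`. -/
@[ext]
structure Hom (A B : PostLieAlg.{v}) where
  /-- the underlying Lie algebra homomorphism -/
  toLieHom : A →ₗ⁅ℝ⁆ B
  map_tri : ∀ x y : A, toLieHom (A.tri x y) = B.tri (toLieHom x) (toLieHom y)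

instance : Category PostLieAlg.{v} where
  Hom := Hom
  id A := ⟨LieHom.id, fun _ _ => rfl⟩
  comp f g := ⟨g.toLieHom.comp f.toLieHom, fun x y => by simp [f.map_tri, g.map_tri]⟩

end PostLieAlg

end

/-! Write `Φ(a) = (L_a)_{*e}` and `D = dΦ_e`, so `x ▷ y = D(x) y`. Every `L_a` fixes `e`, hence all
`Φ(a)` act on the single space `T_eG` and `Φ` is smooth as a map into `End 𝔤`.

Since `L_a` is a group automorphism, `Φ(a)` preserves the bracket; differentiating at `a = e` gives
the derivation axiom (`tri_lie`). For the other axiom, associativity gives `Φ(a · (a ▷ b)) = Φ(a)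
Φ(b)` (`leftDeriv_mul_rhd`). Differentiating in `b` shows that, near `e`, the left-invariant field
of `w` differentiates `Φ` to `Φ(a) D(Φ(a)⁻¹ w)`. A second derivative at `e`, along `x`, gives `D(x)
D(w) - D(x ▷ w)`. Antisymmetrizing, with `[X, Y]` acting as a commutator
(`mvfderiv_mlieBracket_apply`), gives `D[x, y] = [D x, D y] - D(x ▷ y) + D(y ▷ x)`, which is
`lie_tri`.

Homomorphisms relate left-invariant fields and intertwine the maps `L_a`; differentiating gives
functoriality. -/

section

open VectorField Filter Topology

/-! ### Lie brackets as commutators of derivations, and related vector fields -/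

section RelatedVectorFields

variable {E : Type*} [NormedAddCommGroup E] [NormedSpace ℝ E]
  {M : Type*} [TopologicalSpace M] [ChartedSpace E M]
  {E' : Type*} [NormedAddCommGroup E'] [NormedSpace ℝ E']
  {M' : Type*} [TopologicalSpace M'] [ChartedSpace E' M']
  {E'' : Type*} [NormedAddCommGroup E''] [NormedSpace ℝ E'']
  {M'' : Type*} [TopologicalSpace M''] [ChartedSpace E'' M'']
  {F : Type*} [NormedAddCommGroup F] [NormedSpace ℝ F]

/-- Chain rule with the derivatives typed on the model spaces, so that `f x = y` may be a
propositional equality such as `a ▷ 1 = 1` without transport between tangent spaces. -/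
theorem hasMFDerivAt_comp_of_eq {g : M' → M''} {f : M → M'} {x : M} {y : M'}
    {g' : E' →L[ℝ] E''} {f' : E →L[ℝ] E'} (hg : HasMFDerivAt 𝓘(ℝ, E') 𝓘(ℝ, E'') g y g')
    (hf : HasMFDerivAt 𝓘(ℝ, E) 𝓘(ℝ, E') f x f') (h : f x = y) :
    HasMFDerivAt 𝓘(ℝ, E) 𝓘(ℝ, E'') (g ∘ f) x (g' ∘L f') := by
  subst h
  exact hg.comp x hf

/-- A vector field read in a chart acts on functions read in the chart as it does on `M`. -/
theorem fderiv_comp_extChartAt_symm_mpullbackWithin [IsManifold 𝓘(ℝ, E) 1 M] {x : M} {u : E}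
    (hu : u ∈ (extChartAt 𝓘(ℝ, E) x).target) {f : M → F}
    (hf : MDifferentiableAt 𝓘(ℝ, E) 𝓘(ℝ, F) f ((extChartAt 𝓘(ℝ, E) x).symm u))
    (V : Π y : M, TangentSpace 𝓘(ℝ, E) y) :
    fderiv ℝ (f ∘ (extChartAt 𝓘(ℝ, E) x).symm) u
      (mpullbackWithin 𝓘(ℝ, E) 𝓘(ℝ, E) (extChartAt 𝓘(ℝ, E) x).symm V
        (Set.range 𝓘(ℝ, E)) u) =
      mvfderiv 𝓘(ℝ, E) f ((extChartAt 𝓘(ℝ, E) x).symm u)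
        (V ((extChartAt 𝓘(ℝ, E) x).symm u)) := by
  have h1 := mdifferentiableWithinAt_extChartAt_symm (I := 𝓘(ℝ, E)) hu
  have h2 := isInvertible_mfderivWithin_extChartAt_symm (I := 𝓘(ℝ, E)) hu
  rw [mpullbackWithin_apply]
  simp only [modelWithCornersSelf_coe, Set.range_id, mdifferentiableWithinAt_univ,
    mfderivWithin_univ] at h1 h2 ⊢
  rw [← mfderiv_eq_fderiv]
  have h3 := mfderiv_comp u hf h1
  obtain ⟨A, hA⟩ := h2
  rw [← hA] at h3 ⊢
  rw [ContinuousLinearMap.inverse_equiv]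
  refine (DFunLike.congr_fun h3 _).trans ?_
  exact congrArg _ (A.apply_symm_apply _)

theorem mdifferentiableAt_extChartAt_symm_self [IsManifold 𝓘(ℝ, E) 1 M] (x : M) :
    MDifferentiableAt 𝓘(ℝ, E) 𝓘(ℝ, E) (extChartAt 𝓘(ℝ, E) x).symm (extChartAt 𝓘(ℝ, E) x x) := by
  have h := mdifferentiableWithinAt_extChartAt_symm (I := 𝓘(ℝ, E))
    (mem_extChartAt_target (I := 𝓘(ℝ, E)) x)
  rwa [modelWithCornersSelf_coe, Set.range_id, mdifferentiableWithinAt_univ] at h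

theorem mfderiv_extChartAt_inverse_eq [IsManifold 𝓘(ℝ, E) 1 M] (x : M) :
    (mfderiv 𝓘(ℝ, E) 𝓘(ℝ, E) (extChartAt 𝓘(ℝ, E) x) x).inverse =
      mfderiv 𝓘(ℝ, E) 𝓘(ℝ, E) (extChartAt 𝓘(ℝ, E) x).symm (extChartAt 𝓘(ℝ, E) x x) := by
  have h1 := mfderivWithin_extChartAt_symm_comp_mfderiv_extChartAt' (I := 𝓘(ℝ, E))
    (mem_extChartAt_source x)
  have h2 := mfderiv_extChartAt_comp_mfderivWithin_extChartAt_symm' (I := 𝓘(ℝ, E))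
    (mem_extChartAt_source x)
  simp only [modelWithCornersSelf_coe, Set.range_id, mfderivWithin_univ] at h1 h2
  exact ContinuousLinearMap.inverse_eq h2 h1

/-- Differentiability at a point can be read in the chart there. -/
theorem differentiableAt_comp_extChartAt_symm_iff [IsManifold 𝓘(ℝ, E) 1 M] {x : M} {f : M → F} :
    DifferentiableAt ℝ (f ∘ (extChartAt 𝓘(ℝ, E) x).symm) (extChartAt 𝓘(ℝ, E) x x) ↔
      MDifferentiableAt 𝓘(ℝ, E) 𝓘(ℝ, F) f x := by
  rw [← mdifferentiableAt_iff_differentiableAt]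
  have h1 := mdifferentiableAt_extChartAt_symm_self (E := E) x
  have h2 : MDifferentiableAt 𝓘(ℝ, E) 𝓘(ℝ, E) (extChartAt 𝓘(ℝ, E) x) x :=
    mdifferentiableAt_extChartAt (mem_chart_source E x)
  constructor
  · intro h
    refine (h.comp x h2).congr_of_eventuallyEq ?_
    filter_upwards [extChartAt_source_mem_nhds (I := 𝓘(ℝ, E)) x] with y hy
    rw [Function.comp_apply, Function.comp_apply, (extChartAt 𝓘(ℝ, E) x).left_inv hy]
  · intro h
    exact (hasMFDerivAt_comp_of_eq h.hasMFDerivAt h1.hasMFDerivAt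
      (extChartAt_to_inv x)).mdifferentiableAt

/-- The derivatives of a `C²` function along `V` and `W` are differentiable, and its derivative along
`[V, W]` is their commutator. -/
theorem mvfderiv_mlieBracket_apply [CompleteSpace E]
    [IsManifold 𝓘(ℝ, E) 2 M] {x : M} {f : M → F}
    (hf : ContMDiffAt 𝓘(ℝ, E) 𝓘(ℝ, F) 2 f x) {V W : Π y : M, TangentSpace 𝓘(ℝ, E) y}
    (hV : MDifferentiableAt 𝓘(ℝ, E) 𝓘(ℝ, E).tangent (fun y => (V y : TangentBundle 𝓘(ℝ, E) M)) x)
    (hW : MDifferentiableAt 𝓘(ℝ, E) 𝓘(ℝ, E).tangent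
      (fun y => (W y : TangentBundle 𝓘(ℝ, E) M)) x) :
    (MDifferentiableAt 𝓘(ℝ, E) 𝓘(ℝ, F) (fun y => mvfderiv 𝓘(ℝ, E) f y (V y)) x ∧
      MDifferentiableAt 𝓘(ℝ, E) 𝓘(ℝ, F) (fun y => mvfderiv 𝓘(ℝ, E) f y (W y)) x) ∧
    mvfderiv 𝓘(ℝ, E) f x (mlieBracket 𝓘(ℝ, E) V W x) =
      mvfderiv 𝓘(ℝ, E) (fun y => mvfderiv 𝓘(ℝ, E) f y (W y)) x (V x) -
      mvfderiv 𝓘(ℝ, E) (fun y => mvfderiv 𝓘(ℝ, E) f y (V y)) x (W x) := by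
  have : IsManifold 𝓘(ℝ, E) 1 M := IsManifold.of_le (n := 2) one_le_two
  have hx := mem_extChartAt_target (I := 𝓘(ℝ, E)) x
  have hinv : (extChartAt 𝓘(ℝ, E) x).symm (extChartAt 𝓘(ℝ, E) x x) = x := by simp
  have hs : ContMDiffAt 𝓘(ℝ, E) 𝓘(ℝ, E) 2 (extChartAt 𝓘(ℝ, E) x).symm
      (extChartAt 𝓘(ℝ, E) x x) := by
    have h := contMDiffWithinAt_extChartAt_symm_range (I := 𝓘(ℝ, E)) (n := 2) x hx
    rwa [modelWithCornersSelf_coe, Set.range_id, contMDiffWithinAt_univ] at h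
  have hf' : ContDiffAt ℝ 2 (f ∘ (extChartAt 𝓘(ℝ, E) x).symm) (extChartAt 𝓘(ℝ, E) x x) :=
    contMDiffAt_iff_contDiffAt.1 (hf.comp_of_eq hs hinv)
  have hev : ∀ᶠ u in 𝓝 (extChartAt 𝓘(ℝ, E) x x), u ∈ (extChartAt 𝓘(ℝ, E) x).target ∧
      MDifferentiableAt 𝓘(ℝ, E) 𝓘(ℝ, F) f ((extChartAt 𝓘(ℝ, E) x).symm u) := by
    refine Filter.Eventually.and (extChartAt_target_mem_nhds (I := 𝓘(ℝ, E)) x) ?_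
    have h1 : ∀ᶠ y in 𝓝 x, MDifferentiableAt 𝓘(ℝ, E) 𝓘(ℝ, F) f y := by
      filter_upwards [(contMDiffAt_iff_contMDiffAt_nhds (by simp)).1 hf] with y hy
      exact hy.mdifferentiableAt two_ne_zero
    have h2 : Tendsto (extChartAt 𝓘(ℝ, E) x).symm (𝓝 (extChartAt 𝓘(ℝ, E) x x)) (𝓝 x) := by
      simpa [ContinuousAt] using continuousAt_extChartAt_symm (I := 𝓘(ℝ, E)) x
    exact h2.eventually h1
  have hchart : ∀ X : Π y : M, TangentSpace 𝓘(ℝ, E) y,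
      (fun u => fderiv ℝ (f ∘ (extChartAt 𝓘(ℝ, E) x).symm) u
        (mpullbackWithin 𝓘(ℝ, E) 𝓘(ℝ, E) (extChartAt 𝓘(ℝ, E) x).symm X
          (Set.range 𝓘(ℝ, E)) u)) =ᶠ[𝓝 (extChartAt 𝓘(ℝ, E) x x)]
      (fun y => mvfderiv 𝓘(ℝ, E) f y (X y)) ∘ (extChartAt 𝓘(ℝ, E) x).symm := fun X => by
    filter_upwards [hev] with u hu
    exact fderiv_comp_extChartAt_symm_mpullbackWithin hu.1 hu.2 X
  have hd : ∀ X : Π y : M, TangentSpace 𝓘(ℝ, E) y,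
      MDifferentiableAt 𝓘(ℝ, E) 𝓘(ℝ, E).tangent (fun y => (X y : TangentBundle 𝓘(ℝ, E) M)) x →
      DifferentiableAt ℝ (mpullbackWithin 𝓘(ℝ, E) 𝓘(ℝ, E) (extChartAt 𝓘(ℝ, E) x).symm X
          (Set.range 𝓘(ℝ, E))) (extChartAt 𝓘(ℝ, E) x x) := fun X hX => by
    rw [← mdifferentiableWithinAt_univ] at hX
    have h := hX.differentiableWithinAt_mpullbackWithin_vectorField
    rw [Set.preimage_univ, Set.univ_inter, modelWithCornersSelf_coe, Set.range_id] at h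
    rw [modelWithCornersSelf_coe, Set.range_id]
    exact differentiableWithinAt_univ.1 h
  have hm : ∀ X : Π y : M, TangentSpace 𝓘(ℝ, E) y,
      MDifferentiableAt 𝓘(ℝ, E) 𝓘(ℝ, E).tangent (fun y => (X y : TangentBundle 𝓘(ℝ, E) M)) x →
      MDifferentiableAt 𝓘(ℝ, E) 𝓘(ℝ, F) (fun y => mvfderiv 𝓘(ℝ, E) f y (X y)) x :=
    fun X hX => by
      rw [← differentiableAt_comp_extChartAt_symm_iff]
      refine DifferentiableAt.congr_of_eventuallyEq ?_ (hchart X).symm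
      exact ((hf'.fderiv_right (m := 1) (by norm_num)).differentiableAt one_ne_zero).clm_apply
        (hd X hX)
  refine ⟨⟨hm V hV, hm W hW⟩, ?_⟩
  -- In the chart this is the flat commutator formula: second-derivative terms cancel by symmetry.
  have key := fderiv_apply_lieBracket hf' (by simp) (hd W hW) (hd V hV)
  rw [(hchart V).fderiv_eq, (hchart W).fderiv_eq,
    fderiv_comp_extChartAt_symm_mpullbackWithin hx (by rw [hinv]; exact hm W hW),
    fderiv_comp_extChartAt_symm_mpullbackWithin hx (by rw [hinv]; exact hm V hV), hinv] at key
  rw [← key, mlieBracket, mlieBracketWithin_apply, mfderiv_extChartAt_inverse_eq]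
  have h3 := (hasMFDerivAt_comp_of_eq (hf.mdifferentiableAt two_ne_zero).hasMFDerivAt
    (hs.mdifferentiableAt two_ne_zero).hasMFDerivAt hinv).mfderiv
  rw [mfderiv_eq_fderiv] at h3
  rw [Set.preimage_univ, Set.univ_inter, modelWithCornersSelf_coe, Set.range_id]
  refine (DFunLike.congr_fun h3 _).symm.trans (congrArg _ ?_)
  exact congrFun lieBracketWithin_univ _

/-- If `V` and `W` are `f`-related to `V'` and `W'`, then `[V, W]` is `f`-related to
`[V', W']`. -/
theorem mfderiv_mlieBracket_of_related [CompleteSpace E] [CompleteSpace E']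
    [IsManifold 𝓘(ℝ, E) 2 M] [IsManifold 𝓘(ℝ, E') 2 M'] {x : M} {f : M → M'}
    (hf : ContMDiff 𝓘(ℝ, E) 𝓘(ℝ, E') 2 f)
    {V W : Π y : M, TangentSpace 𝓘(ℝ, E) y} {V' W' : Π y : M', TangentSpace 𝓘(ℝ, E') y}
    (hV : MDifferentiableAt 𝓘(ℝ, E) 𝓘(ℝ, E).tangent (fun y => (V y : TangentBundle 𝓘(ℝ, E) M)) x)
    (hW : MDifferentiableAt 𝓘(ℝ, E) 𝓘(ℝ, E).tangent
      (fun y => (W y : TangentBundle 𝓘(ℝ, E) M)) x)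
    (hV' : MDifferentiableAt 𝓘(ℝ, E') 𝓘(ℝ, E').tangent
      (fun y => (V' y : TangentBundle 𝓘(ℝ, E') M')) (f x))
    (hW' : MDifferentiableAt 𝓘(ℝ, E') 𝓘(ℝ, E').tangent
      (fun y => (W' y : TangentBundle 𝓘(ℝ, E') M')) (f x))
    (hVV' : ∀ y, mfderiv 𝓘(ℝ, E) 𝓘(ℝ, E') f y (V y) = V' (f y))
    (hWW' : ∀ y, mfderiv 𝓘(ℝ, E) 𝓘(ℝ, E') f y (W y) = W' (f y)) :
    mfderiv 𝓘(ℝ, E) 𝓘(ℝ, E') f x (mlieBracket 𝓘(ℝ, E) V W x) =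
      mlieBracket 𝓘(ℝ, E') V' W' (f x) := by
  have : IsManifold 𝓘(ℝ, E') 1 M' := IsManifold.of_le (n := 2) one_le_two
  have hfd := hf.mdifferentiable two_ne_zero
  have hφ : ContMDiffAt 𝓘(ℝ, E') 𝓘(ℝ, E') 2 (extChartAt 𝓘(ℝ, E') (f x)) (f x) :=
    contMDiffAt_extChartAt
  -- The chart at `f x` has injective differential there, so the two brackets may be compared after
  -- applying it; the commutator formula is then used for the chart and for its composite with `f`.
  have hinj : Function.Injective
      (mvfderiv 𝓘(ℝ, E') (extChartAt 𝓘(ℝ, E') (f x)) (f x)) :=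
    (isInvertible_mfderiv_extChartAt (mem_extChartAt_source (I := 𝓘(ℝ, E')) (f x))).injective
  have hchain : ∀ (h : M' → E') (y : M), MDifferentiableAt 𝓘(ℝ, E') 𝓘(ℝ, E') h (f y) →
      ∀ v, mvfderiv 𝓘(ℝ, E) (h ∘ f) y v =
        mvfderiv 𝓘(ℝ, E') h (f y) (mfderiv 𝓘(ℝ, E) 𝓘(ℝ, E') f y v) := fun h y hh v =>
    DFunLike.congr_fun (mfderiv_comp y hh (hfd y)) v
  have hev : ∀ᶠ y in 𝓝 x, MDifferentiableAt 𝓘(ℝ, E') 𝓘(ℝ, E')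
      (extChartAt 𝓘(ℝ, E') (f x)) (f y) := by
    refine hf.continuous.continuousAt.eventually ?_
    filter_upwards [(contMDiffAt_iff_contMDiffAt_nhds (by simp)).1 hφ] with y hy
    exact hy.mdifferentiableAt two_ne_zero
  have hrel : ∀ (X : Π y : M, TangentSpace 𝓘(ℝ, E) y) (X' : Π y : M', TangentSpace 𝓘(ℝ, E') y),
      (∀ y, mfderiv 𝓘(ℝ, E) 𝓘(ℝ, E') f y (X y) = X' (f y)) →
      (fun y => mvfderiv 𝓘(ℝ, E) (extChartAt 𝓘(ℝ, E') (f x) ∘ f) y (X y)) =ᶠ[𝓝 x]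
      (fun z => mvfderiv 𝓘(ℝ, E') (extChartAt 𝓘(ℝ, E') (f x)) z (X' z)) ∘ f := by
    intro X X' h
    filter_upwards [hev] with y hy
    rw [hchain _ y hy, h]
    rfl
  obtain ⟨-, h1⟩ := mvfderiv_mlieBracket_apply (hφ.comp x (hf x)) hV hW
  obtain ⟨⟨h3, h4⟩, h2⟩ := mvfderiv_mlieBracket_apply hφ hV' hW'
  have hcongr : ∀ {h₁ h₂ : M → E'}, h₁ =ᶠ[𝓝 x] h₂ →
      mvfderiv 𝓘(ℝ, E) h₁ x = mvfderiv 𝓘(ℝ, E) h₂ x := fun h => by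
    unfold mvfderiv
    ext v
    exact DFunLike.congr_fun h.mfderiv_eq v
  apply hinj
  rw [h2, ← hchain _ x hev.self_of_nhds, h1, hcongr (hrel V V' hVV'), hcongr (hrel W W' hWW'),
    hchain _ x h3, hchain _ x h4, hVV', hWW']

end RelatedVectorFields

/-! ### Units in a post-group -/

namespace PostGroup

variable {G : Type*} [PostGroup G]

theorem rhd_one (a : G) : rhd a 1 = 1 := by
  have h := rhd_mul a 1 1
  rwa [mul_one, left_eq_mul] at h

/-- Associativity gives `1 ▷ (1 ▷ b) = 1 ▷ b`, and `1 ▷ ·` is injective. -/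
theorem one_rhd (b : G) : rhd 1 b = b := by
  apply (rhd_bijective (1 : G)).1
  have h := rhd_assoc (1 : G) 1 b
  rwa [rhd_one, mul_one, eq_comm] at h

end PostGroup

/-! ### Smoothness of `a ↦ (L_a)_{*e}` and its derivative along curves -/

namespace PostLieGrp

variable {G H : PostLieGrp.{u, v}}

instance (G : PostLieGrp.{u, v}) : IsManifold 𝓘(ℝ, G.E) 2 G :=
  IsManifold.of_le (n := ∞) (by exact_mod_cast ENat.LEInfty.out)

instance (G : PostLieGrp.{u, v}) : IsManifold 𝓘(ℝ, G.E) 1 G :=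
  IsManifold.of_le (n := 2) one_le_two

theorem mdifferentiable_mul_left (a : G) :
    MDifferentiable 𝓘(ℝ, G.E) 𝓘(ℝ, G.E) (fun b : G => a * b) :=
  (contMDiff_mul_left (I := 𝓘(ℝ, G.E)) (n := ∞)).mdifferentiable (by simp)

theorem contMDiff_rhd_left (a : G) :
    ContMDiff 𝓘(ℝ, G.E) 𝓘(ℝ, G.E) ∞ (fun b : G => PostGroup.rhd a b) :=
  (PostLieGroup.contMDiff_rhd (E := G.E) (G := G)).comp
    (contMDiff_const.prodMk contMDiff_id)

theorem hasMFDerivAt_rhd (a : G) :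
    HasMFDerivAt 𝓘(ℝ, G.E) 𝓘(ℝ, G.E) (fun b : G => PostGroup.rhd a b) 1 (G.leftDeriv a) :=
  ((contMDiff_rhd_left a).mdifferentiable (by simp) 1).hasMFDerivAt

theorem leftDeriv_one (G : PostLieGrp.{u, v}) : G.leftDeriv 1 = ContinuousLinearMap.id ℝ G.E := by
  have h : (fun b : G => PostGroup.rhd 1 b) = id := funext PostGroup.one_rhd
  unfold leftDeriv
  rw [h]
  exact mfderiv_id

theorem contMDiff_leftDeriv (G : PostLieGrp.{u, v}) :
    ContMDiff 𝓘(ℝ, G.E) 𝓘(ℝ, G.E →L[ℝ] G.E) ∞ G.leftDeriv := by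
  intro a
  have h := ContMDiffAt.mfderiv (m := ∞) (n := ∞) (I := 𝓘(ℝ, G.E)) (I' := 𝓘(ℝ, G.E)) (x₀ := a)
    (fun a b : G => PostGroup.rhd a b) (fun _ => (1 : G))
    (PostLieGroup.contMDiff_rhd (E := G.E) (G := G) (a, 1)) contMDiffAt_const (by simp)
  change ContMDiffAt _ _ _ (inTangentCoordinates 𝓘(ℝ, G.E) 𝓘(ℝ, G.E) (fun _ : G => (1 : G))
    (fun b : G => PostGroup.rhd b 1) G.leftDeriv a) a at h
  -- Both base points are now constantly `1`, so the coordinate changes are identities and the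
  -- expression in tangent coordinates is `leftDeriv` itself.
  rw [show (fun b : G => PostGroup.rhd b 1) = fun _ => 1 from funext PostGroup.rhd_one] at h
  refine h.congr_of_eventuallyEq (Eventually.of_forall fun b => ?_)
  have hc : ∀ w : G.E, (tangentBundleCore 𝓘(ℝ, G.E) G).coordChange (achart G.E (1 : G))
      (achart G.E (1 : G)) 1 w = w := fun w =>
    (tangentBundleCore 𝓘(ℝ, G.E) G).coordChange_self (achart G.E (1 : G)) 1
      (mem_chart_source G.E (1 : G)) w
  ext v
  refine Eq.symm ((DFunLike.congr_fun (inTangentCoordinates_eq (fun _ : G => (1 : G))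
    (fun _ : G => (1 : G)) G.leftDeriv (x₀ := a) (x := b) (mem_chart_source G.E (1 : G))
    (mem_chart_source G.E (1 : G))) v).trans ?_)
  exact (hc _).trans (congrArg (G.leftDeriv b) (hc v))

theorem hasMFDerivAt_leftDeriv (G : PostLieGrp.{u, v}) :
    HasMFDerivAt 𝓘(ℝ, G.E) 𝓘(ℝ, G.E →L[ℝ] G.E) G.leftDeriv 1 G.leftDerivDeriv :=
  ((contMDiff_leftDeriv G).mdifferentiable (by simp) 1).hasMFDerivAt

theorem hasMFDerivAt_leftDeriv_apply (G : PostLieGrp.{u, v}) (y : G.E) :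
    HasMFDerivAt 𝓘(ℝ, G.E) 𝓘(ℝ, G.E) (fun a => G.leftDeriv a y) 1
      ((ContinuousLinearMap.apply ℝ G.E y) ∘L G.leftDerivDeriv) :=
  hasMFDerivAt_comp_of_eq (ContinuousLinearMap.apply ℝ G.E y).hasMFDerivAt
    (hasMFDerivAt_leftDeriv G) rfl

/-- The data of a curve through the identity, as a derivative. -/
theorem IsCurveAt.hasMFDerivAt {γ : ℝ → G} {x : G.lieAlg} (h : G.IsCurveAt γ x) :
    HasMFDerivAt 𝓘(ℝ, ℝ) 𝓘(ℝ, G.E) γ 0 (ContinuousLinearMap.toSpanSingleton ℝ (x : G.E)) := by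
  have h1 : (mfderiv 𝓘(ℝ, ℝ) 𝓘(ℝ, G.E) γ 0 : ℝ →L[ℝ] G.E) =
      ContinuousLinearMap.toSpanSingleton ℝ (x : G.E) :=
    ContinuousLinearMap.ext_ring
      (h.velocity.trans (one_smul ℝ (x : G.E)).symm)
  exact (congrArg (fun A : ℝ →L[ℝ] G.E => HasMFDerivAt 𝓘(ℝ, ℝ) 𝓘(ℝ, G.E) γ 0 A) h1).mp
    h.mdifferentiableAt.hasMFDerivAt

theorem IsCurveAt.hasDerivAt_leftDeriv {γ : ℝ → G} {x : G.lieAlg} (h : G.IsCurveAt γ x)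
    (y : G.E) : HasDerivAt (fun t : ℝ => G.leftDeriv (γ t) y) (G.leftDerivDeriv x y) 0 := by
  have h1 : HasFDerivAt (fun t : ℝ => G.leftDeriv (γ t) y)
      ((ContinuousLinearMap.apply ℝ G.E y ∘L G.leftDerivDeriv) ∘L
        ContinuousLinearMap.toSpanSingleton ℝ (x : G.E)) 0 :=
    (hasMFDerivAt_comp_of_eq (hasMFDerivAt_leftDeriv_apply G y) h.hasMFDerivAt
      h.map_zero).hasFDerivAt
  refine h1.hasDerivAt.congr_deriv ?_
  exact congrArg (fun z : G.E => G.leftDerivDeriv z y) (one_smul ℝ (x : G.E))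

theorem IsCurveAt.hasMFDerivAt_rhd {σ : ℝ → G} {y : G.lieAlg} (h : G.IsCurveAt σ y) (a : G) :
    HasMFDerivAt 𝓘(ℝ, ℝ) 𝓘(ℝ, G.E) (fun s => PostGroup.rhd a (σ s)) 0
      (G.leftDeriv a ∘L ContinuousLinearMap.toSpanSingleton ℝ (y : G.E)) :=
  hasMFDerivAt_comp_of_eq (PostLieGrp.hasMFDerivAt_rhd a) h.hasMFDerivAt h.map_zero

theorem IsCurveAt.mfderiv_rhd {σ : ℝ → G} {y : G.lieAlg} (h : G.IsCurveAt σ y) (a : G) :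
    (mfderiv 𝓘(ℝ, ℝ) 𝓘(ℝ, G.E) (fun s => PostGroup.rhd a (σ s)) 0 (1 : ℝ) : G.E) =
      G.leftDeriv a y := by
  refine (DFunLike.congr_fun (h.hasMFDerivAt_rhd a).mfderiv (1 : ℝ)).trans ?_
  exact congrArg (G.leftDeriv a) (one_smul ℝ (y : G.E))

/-! ### Differentials of homomorphisms -/

section Homomorphisms

variable {f : G → H}

theorem map_one_of_map_mul (hmul : ∀ a b, f (a * b) = f a * f b) : f 1 = 1 := by
  have h := hmul 1 1
  rwa [mul_one, left_eq_mul] at h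

/-- The differential at the identity of a smooth homomorphism relates left-invariant vector
fields. -/
theorem mfderiv_mulInvariantVectorField (hmul : ∀ a b, f (a * b) = f a * f b)
    (hf : MDifferentiable 𝓘(ℝ, G.E) 𝓘(ℝ, H.E) f) {D : G.lieAlg →L[ℝ] H.lieAlg}
    (hD : HasMFDerivAt 𝓘(ℝ, G.E) 𝓘(ℝ, H.E) f 1 D) (v : G.lieAlg) (a : G) :
    mfderiv 𝓘(ℝ, G.E) 𝓘(ℝ, H.E) f a (mulInvariantVectorField v a) =
      mulInvariantVectorField (D v) (f a) := by
  have h1 := hasMFDerivAt_comp_of_eq (hf a).hasMFDerivAt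
    (mdifferentiable_mul_left a 1).hasMFDerivAt (mul_one a)
  have h2 := hasMFDerivAt_comp_of_eq (mdifferentiable_mul_left (f a) 1).hasMFDerivAt
    hD (map_one_of_map_mul hmul)
  -- The two chain rules at `1` compute the derivative of this one map.
  have h3 : f ∘ (fun b => a * b) = (fun b => f a * b) ∘ f := funext (hmul a)
  rw [h3] at h1
  exact DFunLike.congr_fun (hasMFDerivAt_unique h1 h2) v

/-- The differential at the identity of a smooth homomorphism preserves brackets. -/
theorem map_lie_of_hasMFDerivAt (hmul : ∀ a b, f (a * b) = f a * f b)
    (hf : ContMDiff 𝓘(ℝ, G.E) 𝓘(ℝ, H.E) ∞ f) {D : G.lieAlg →L[ℝ] H.lieAlg}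
    (hD : HasMFDerivAt 𝓘(ℝ, G.E) 𝓘(ℝ, H.E) f 1 D) (x y : G.lieAlg) :
    D ⁅x, y⁆ = ⁅D x, D y⁆ := by
  have hfd := hf.mdifferentiable (by simp)
  have h := mfderiv_mlieBracket_of_related (x := (1 : G))
    (hf.of_le (by exact_mod_cast ENat.LEInfty.out))
    (mdifferentiableAt_mulInvariantVectorField x) (mdifferentiableAt_mulInvariantVectorField y)
    (mdifferentiableAt_mulInvariantVectorField _) (mdifferentiableAt_mulInvariantVectorField _)
    (mfderiv_mulInvariantVectorField hmul hfd hD x) (mfderiv_mulInvariantVectorField hmul hfd hD y)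
  rw [GroupLieAlgebra.bracket_def, GroupLieAlgebra.bracket_def,
    ← map_one_of_map_mul hmul]
  exact (DFunLike.congr_fun hD.mfderiv _).symm.trans h

/-- The differential at the identity of a homomorphism of post-Lie groups preserves `▷`. -/
theorem map_tri_of_hasMFDerivAt (hmul : ∀ a b, f (a * b) = f a * f b)
    (hrhd : ∀ a b, f (PostGroup.rhd a b) = PostGroup.rhd (f a) (f b))
    {D : G.lieAlg →L[ℝ] H.lieAlg}
    (hD : HasMFDerivAt 𝓘(ℝ, G.E) 𝓘(ℝ, H.E) f 1 D) (x y : G.lieAlg) :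
    D (G.tri x y) = H.tri (D x) (D y) := by
  have hone := map_one_of_map_mul hmul
  -- Differentiating `f ∘ L_a = L_{f a} ∘ f` at `1`; the resulting identity is differentiated once
  -- more below, now in `a`.
  have h (a : G) : D (G.leftDeriv a y) = H.leftDeriv (f a) (D y) := by
    have h1 := hasMFDerivAt_comp_of_eq hD (hasMFDerivAt_rhd a) (PostGroup.rhd_one a)
    have h2 := hasMFDerivAt_comp_of_eq (hasMFDerivAt_rhd (f a)) hD hone
    have h3 : f ∘ (fun b => PostGroup.rhd a b) = (fun b => PostGroup.rhd (f a) b) ∘ f :=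
      funext (hrhd a)
    rw [h3] at h1
    exact DFunLike.congr_fun (hasMFDerivAt_unique h1 h2) y
  have h1 := hasMFDerivAt_comp_of_eq
    (ContinuousLinearMap.hasMFDerivAt (E := G.E) (E' := H.E) D)
    (hasMFDerivAt_leftDeriv_apply G y) rfl
  have h2 := hasMFDerivAt_comp_of_eq (hasMFDerivAt_leftDeriv_apply H (D y)) hD hone
  have h3 := h1.congr_of_eventuallyEq (f₁ := (fun a => H.leftDeriv a (D y)) ∘ f)
    (Eventually.of_forall fun a => (h a).symm)
  exact DFunLike.congr_fun (hasMFDerivAt_unique h3 h2) x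

end Homomorphisms

/-! ### The two post-Lie axioms -/

/-- The bracket as a continuous bilinear map on the model space. -/
theorem exists_continuous_bracket (G : PostLieGrp.{u, v}) :
    ∃ β : G.E →L[ℝ] G.E →L[ℝ] G.E, ∀ x y : G.lieAlg, (β x y : G.E) = (⁅x, y⁆ : G.lieAlg) := by
  let b : G.lieAlg → G.lieAlg → G.lieAlg := fun x y => ⁅x, y⁆
  let B : G.E →ₗ[ℝ] G.E →ₗ[ℝ] G.E := LinearMap.mk₂ ℝ b
    (fun x x' y => add_lie (L := G.lieAlg) (M := G.lieAlg) x x' y)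
    (fun c x y => smul_lie (L := G.lieAlg) (M := G.lieAlg) c x y)
    (fun x y y' => lie_add (L := G.lieAlg) (M := G.lieAlg) x y y')
    (fun c x y => lie_smul (L := G.lieAlg) (M := G.lieAlg) c x y)
  -- Finite dimension supplies continuity, which allows the bracket to be differentiated.
  exact ⟨LinearMap.toContinuousBilinearMap B, fun x y =>
    LinearMap.toContinuousBilinearMap_apply ..⟩

/-- Each `L_a` is a smooth automorphism, so its differential preserves brackets; the product rule at
`a = 1` gives the derivation property. -/
theorem tri_lie (x y z : G.lieAlg) : G.tri x ⁅y, z⁆ = ⁅G.tri x y, z⁆ + ⁅y, G.tri x z⁆ := by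
  obtain ⟨β, hβ⟩ := exists_continuous_bracket G
  have h (a : G) : G.leftDeriv a (β y z) = β (G.leftDeriv a y) (G.leftDeriv a z) := by
    have h1 := map_lie_of_hasMFDerivAt (PostGroup.rhd_mul a) (contMDiff_rhd_left a)
      (hasMFDerivAt_rhd a) y z
    rw [hβ]
    exact h1.trans (hβ _ _).symm
  have hy := (β.isBoundedBilinearMap.hasFDerivAt (G.leftDeriv 1 y, G.leftDeriv 1 z))
  have hA : ∀ w : G.E, HasFDerivAt (fun A : G.E →L[ℝ] G.E => A w)
      (ContinuousLinearMap.apply ℝ G.E w) (G.leftDeriv 1) := fun w =>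
    (ContinuousLinearMap.apply ℝ G.E w).hasFDerivAt
  have h1 := hasMFDerivAt_comp_of_eq (hy.comp (G.leftDeriv 1)
    ((hA y).prodMk (hA z))).hasMFDerivAt (hasMFDerivAt_leftDeriv G) rfl
  have h2 := h1.congr_of_eventuallyEq (f₁ := fun a => G.leftDeriv a (β y z))
    (Eventually.of_forall h)
  have h3 := DFunLike.congr_fun (hasMFDerivAt_unique (hasMFDerivAt_leftDeriv_apply G (β y z)) h2) x
  rw [← hβ, ← hβ, ← hβ]
  refine h3.trans ?_
  change β (G.leftDeriv 1 y) (G.leftDerivDeriv x z) +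
    β (G.leftDerivDeriv x y) (G.leftDeriv 1 z) = _
  rw [leftDeriv_one]
  exact add_comm _ _

theorem leftDeriv_mul_rhd (a b : G) :
    G.leftDeriv (a * PostGroup.rhd a b) = G.leftDeriv a ∘L G.leftDeriv b := by
  have h1 := hasMFDerivAt_comp_of_eq (hasMFDerivAt_rhd a) (hasMFDerivAt_rhd b)
    (PostGroup.rhd_one b)
  have h2 : (fun c => PostGroup.rhd a c) ∘ (fun c => PostGroup.rhd b c) =
      fun c => PostGroup.rhd (a * PostGroup.rhd a b) c :=
    funext fun c => (PostGroup.rhd_assoc a b c).symm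
  rw [h2] at h1
  exact hasMFDerivAt_unique (hasMFDerivAt_rhd _) h1

/-- The derivative of `a ↦ (L_a)_{*e}` along left-invariant vector fields. -/
theorem mvfderiv_leftDeriv_mulInvariantVectorField (a : G) (y : G.E) :
    mvfderiv 𝓘(ℝ, G.E) G.leftDeriv a
      (mulInvariantVectorField (I := 𝓘(ℝ, G.E)) (G := G) (G.leftDeriv a y) a) =
      G.leftDeriv a ∘L G.leftDerivDeriv y := by
  have h0 := hasMFDerivAt_comp_of_eq (mdifferentiable_mul_left a 1).hasMFDerivAt
    (hasMFDerivAt_rhd a) (PostGroup.rhd_one a)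
  -- Both sides of `leftDeriv_mul_rhd` are differentiated in `b` at `1`, with `a` fixed.
  have h1 := hasMFDerivAt_comp_of_eq
    ((contMDiff_leftDeriv G).mdifferentiable (by simp) a).hasMFDerivAt h0
    (by simp [PostGroup.rhd_one])
  have h2 := hasMFDerivAt_comp_of_eq
    (ContinuousLinearMap.compL ℝ G.E G.E G.E (G.leftDeriv a)).hasMFDerivAt
    (hasMFDerivAt_leftDeriv G) rfl
  have h3 := h2.congr_of_eventuallyEq
    (f₁ := G.leftDeriv ∘ ((fun b => a * b) ∘ fun b => PostGroup.rhd a b))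
    (Eventually.of_forall fun b => leftDeriv_mul_rhd a b)
  exact DFunLike.congr_fun (hasMFDerivAt_unique h1 h3) y

/-- Substitute `Φ(a)⁻¹ w` for `y` in the preceding formula: `Φ(1)` is the identity and units are
open, so `Φ(a)` is invertible near `1`. The derivative becomes a function of `Φ(a)` alone, ready to
be differentiated again. -/
theorem eventually_mvfderiv_leftDeriv (w : G.E) :
    (fun a : G => mvfderiv 𝓘(ℝ, G.E) G.leftDeriv a
      (mulInvariantVectorField (I := 𝓘(ℝ, G.E)) (G := G) w a)) =ᶠ[𝓝 1]
      (fun A : G.E →L[ℝ] G.E => A ∘L G.leftDerivDeriv (Ring.inverse A w)) ∘ G.leftDeriv := by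
  have h1 : ∀ᶠ A in 𝓝 (G.leftDeriv 1), IsUnit A :=
    Units.isOpen.mem_nhds (by rw [leftDeriv_one]; exact isUnit_one)
  filter_upwards [(contMDiff_leftDeriv G).continuous.continuousAt.eventually h1] with a ha
  have h2 := mvfderiv_leftDeriv_mulInvariantVectorField a (Ring.inverse (G.leftDeriv a) w)
  have h3 : G.leftDeriv a (Ring.inverse (G.leftDeriv a) w) = w :=
    DFunLike.congr_fun (Ring.mul_inverse_cancel (G.leftDeriv a) ha) w
  rwa [h3] at h2

/-- Product rule for `A ↦ A ∘ D(A⁻¹ w)` at `A = 1` in the direction `D x`; the derivative of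
inversion there is `-1`, whence the minus sign. -/
theorem mvfderiv_mvfderiv_leftDeriv (x w : G.E) :
    mvfderiv 𝓘(ℝ, G.E) (fun a : G => mvfderiv 𝓘(ℝ, G.E) G.leftDeriv a
      (mulInvariantVectorField (I := 𝓘(ℝ, G.E)) (G := G) w a)) 1 x =
      G.leftDerivDeriv x ∘L G.leftDerivDeriv w - G.leftDerivDeriv (G.leftDerivDeriv x w) := by
  have hi : HasFDerivAt (𝕜 := ℝ) Ring.inverse
      (-ContinuousLinearMap.mulLeftRight ℝ (G.E →L[ℝ] G.E) 1 1) (G.leftDeriv 1) := by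
    rw [leftDeriv_one]
    simpa using! hasFDerivAt_ringInverse (𝕜 := ℝ) (1 : (G.E →L[ℝ] G.E)ˣ)
  have hw := (G.leftDerivDeriv ∘L ContinuousLinearMap.apply ℝ G.E w).hasFDerivAt.comp _ hi
  have h1 := hasMFDerivAt_comp_of_eq ((hasFDerivAt_id (G.leftDeriv 1)).clm_comp hw).hasMFDerivAt
    (hasMFDerivAt_leftDeriv G) rfl
  have h2 := h1.congr_of_eventuallyEq (eventually_mvfderiv_leftDeriv w)
  refine (DFunLike.congr_fun h2.mfderiv x).trans ?_
  change G.leftDeriv 1 ∘L G.leftDerivDeriv ((-(1 * G.leftDerivDeriv x * 1)) w) +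
    G.leftDerivDeriv x ∘L G.leftDerivDeriv (Ring.inverse (G.leftDeriv 1) w) = _
  have hinv : Ring.inverse (ContinuousLinearMap.id ℝ G.E) = ContinuousLinearMap.id ℝ G.E :=
    Ring.inverse_one _
  rw [leftDeriv_one, hinv, one_mul, mul_one, ContinuousLinearMap.id_comp,
    ContinuousLinearMap.id_apply, _root_.neg_apply, map_neg, add_comm,
    sub_eq_add_neg]

theorem lie_tri (x y z : G.lieAlg) :
    G.tri (⁅x, y⁆ + G.tri x y - G.tri y x) z = G.tri x (G.tri y z) - G.tri y (G.tri x z) := by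
  have hone : ∀ v : G.lieAlg, mulInvariantVectorField v (1 : G) = v := fun v => by
    have h : (fun b : G => 1 * b) = id := funext one_mul
    unfold mulInvariantVectorField
    rw [h, mfderiv_id]
    rfl
  -- The commutator formula for `Φ` along the left-invariant fields of `x` and `y`, at `1`.
  obtain ⟨-, h⟩ := mvfderiv_mlieBracket_apply (((contMDiff_leftDeriv G).of_le
      (by exact_mod_cast ENat.LEInfty.out)) 1)
    (mdifferentiableAt_mulInvariantVectorField x) (mdifferentiableAt_mulInvariantVectorField y)
  rw [hone, hone] at h
  have h1 : G.leftDerivDeriv (⁅x, y⁆ : G.lieAlg) = _ := h.trans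
    (congrArg₂ (· - ·) (mvfderiv_mvfderiv_leftDeriv x y) (mvfderiv_mvfderiv_leftDeriv y x))
  have h2 (u v w : G.E) : G.leftDerivDeriv (u + v - w) z =
      G.leftDerivDeriv u z + G.leftDerivDeriv v z - G.leftDerivDeriv w z := by
    rw [map_sub, map_add]
    rfl
  refine (h2 (⁅x, y⁆ : G.lieAlg) (G.leftDerivDeriv x y) (G.leftDerivDeriv y x)).trans ?_
  rw [h1]
  change (G.leftDerivDeriv x (G.leftDerivDeriv y z) - G.leftDerivDeriv (G.leftDerivDeriv x y) z -
      (G.leftDerivDeriv y (G.leftDerivDeriv x z) - G.leftDerivDeriv (G.leftDerivDeriv y x) z)) +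
      G.leftDerivDeriv (G.leftDerivDeriv x y) z - G.leftDerivDeriv (G.leftDerivDeriv y x) z =
    (G.leftDerivDeriv x (G.leftDerivDeriv y z) - G.leftDerivDeriv y (G.leftDerivDeriv x z) : G.E)
  abel

/-! ### The functor to post-Lie algebras -/

theorem Hom.hasMFDerivAt_one (Ψ : Hom G H) :
    HasMFDerivAt 𝓘(ℝ, G.E) 𝓘(ℝ, H.E) Ψ.toFun 1
      (mfderiv 𝓘(ℝ, G.E) 𝓘(ℝ, H.E) Ψ.toFun 1 : G.E →L[ℝ] H.E) :=
  (Ψ.contMDiff.mdifferentiable (by simp) 1).hasMFDerivAt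

/-- The functor sending a post-Lie group to its post-Lie algebra. -/
noncomputable def toPostLieAlg : PostLieGrp.{u, v} ⥤ PostLieAlg.{v} where
  obj G := ⟨G.lieAlg, G.tri, ⟨tri_lie, lie_tri⟩⟩
  map Ψ :=
    { toLieHom :=
        { Hom.tangent Ψ with
          map_lie' := fun {x y} =>
            map_lie_of_hasMFDerivAt Ψ.map_mul Ψ.contMDiff Ψ.hasMFDerivAt_one x y }
      map_tri := fun x y =>
        map_tri_of_hasMFDerivAt Ψ.map_mul Ψ.map_rhd Ψ.hasMFDerivAt_one x y }
  map_id G := by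
    apply PostLieAlg.Hom.ext
    apply LieHom.ext
    intro x
    exact DFunLike.congr_fun (mfderiv_id (I := 𝓘(ℝ, G.E)) (x := (1 : G))) x
  map_comp Φ Ψ := by
    apply PostLieAlg.Hom.ext
    apply LieHom.ext
    intro x
    exact DFunLike.congr_fun (hasMFDerivAt_comp_of_eq (Hom.hasMFDerivAt_one Ψ)
      (Hom.hasMFDerivAt_one Φ) (map_one_of_map_mul Φ.map_mul)).mfderiv x

end PostLieGrp

end

theorem mainTheorem4 :
    -- the map `a ↦ (L_a)_{*e}` from `G` to `End 𝔤` is smooth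
    (∀ G : PostLieGrp.{u, v},
      ContMDiff 𝓘(ℝ, G.E) 𝓘(ℝ, G.E →L[ℝ] G.E) ∞ G.leftDeriv) ∧
    -- `x ▷ y = d/dt|₀ (L_{γ(t)})_{*e} y = d/dt|₀ d/ds|₀ γ(t) ▷ σ(s)` for all curves `γ`, `σ`
    -- through the identity with velocities `x`, `y`
    (∀ (G : PostLieGrp.{u, v}) (x y : G.lieAlg) (γ : ℝ → G), G.IsCurveAt γ x →
      HasDerivAt (fun t : ℝ => G.leftDeriv (γ t) y) (G.tri x y : G.E) 0 ∧
      ∀ σ : ℝ → G, G.IsCurveAt σ y →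
        (∀ t : ℝ, MDifferentiableAt 𝓘(ℝ, ℝ) 𝓘(ℝ, G.E)
          (fun s : ℝ => PostGroup.rhd (γ t) (σ s)) 0) ∧
        HasDerivAt
          (fun t : ℝ => (mfderiv 𝓘(ℝ, ℝ) 𝓘(ℝ, G.E)
            (fun s : ℝ => PostGroup.rhd (γ t) (σ s)) 0 (1 : ℝ) : G.E))
          (G.tri x y : G.E) 0) ∧
    -- `(𝔤, [·,·], ▷)` is a post-Lie algebra
    ∃ hobj : ∀ G : PostLieGrp.{u, v}, IsPostLieAlgebra ℝ G.lieAlg G.tri,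
    -- `Ψ_{*e}` preserves the bracket and `▷`
    ∃ hlie : ∀ (G H : PostLieGrp.{u, v}) (Ψ : G ⟶ H) (x y : G.lieAlg),
      PostLieGrp.Hom.tangent Ψ ⁅x, y⁆ =
        ⁅PostLieGrp.Hom.tangent Ψ x, PostLieGrp.Hom.tangent Ψ y⁆,
    ∃ htri : ∀ (G H : PostLieGrp.{u, v}) (Ψ : G ⟶ H) (x y : G.lieAlg),
      PostLieGrp.Hom.tangent Ψ (G.tri x y) =
        H.tri (PostLieGrp.Hom.tangent Ψ x) (PostLieGrp.Hom.tangent Ψ y),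
    -- `G ↦ (𝔤, [·,·], ▷)`, `Ψ ↦ Ψ_{*e}` is a functor
    ∃ F : PostLieGrp.{u, v} ⥤ PostLieAlg.{v},
      F.toPrefunctor =
        { obj := fun G => ⟨G.lieAlg, G.tri, hobj G⟩
          map := fun {G H} Ψ =>
            { toLieHom :=
                { PostLieGrp.Hom.tangent Ψ with map_lie' := fun {x y} => hlie G H Ψ x y }
              map_tri := fun x y => htri G H Ψ x y } } := by
  refine ⟨PostLieGrp.contMDiff_leftDeriv, fun G x y γ hγ => ⟨hγ.hasDerivAt_leftDeriv y,
    fun σ hσ => ⟨fun t => (hσ.hasMFDerivAt_rhd (γ t)).mdifferentiableAt, ?_⟩⟩,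
    fun G => ⟨PostLieGrp.tri_lie, PostLieGrp.lie_tri⟩,
    fun G H Ψ x y => PostLieGrp.map_lie_of_hasMFDerivAt Ψ.map_mul Ψ.contMDiff
      Ψ.hasMFDerivAt_one x y,
    fun G H Ψ x y => PostLieGrp.map_tri_of_hasMFDerivAt Ψ.map_mul Ψ.map_rhd
      Ψ.hasMFDerivAt_one x y,
    PostLieGrp.toPostLieAlg, rfl⟩
  -- For every `t` the inner `s`-derivative is `(L_{γ(t)})_{*e} y`, so the iterated derivative
  -- reduces to the single one.
  exact (hγ.hasDerivAt_leftDeriv y).congr_of_eventuallyEq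
    (Filter.Eventually.of_forall fun t => hσ.mfderiv_rhd (γ t))
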